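/- A camera is a real $3\times 4$ matrix of rank three; its focus is the unique point of $\mathbb{P}^3_{\mathbb{R}}$ in its kernel. Let $\mathcal{A}=(A_1,\ldots,A_n)$ be an arrangement of cameras with foci $\mathbf{c}_1,\ldots,\mathbf{c}_n$, and let $\varphi_{\mathcal{A}}:\mathbb{P}^3_{\mathbb{R}}\smallsetminus\{\mathbf{c}_1,\ldots,\mathbf{c}_n\}\to(\mathbb{P}^2_{\mathbb{R}})^n$ be the map $\mathbf{q}\mapsto(A_1\mathbf{q},\ldots,A_n\mathbf{q})$. The multiview ideal $M_{\mathcal{A}}\subseteq\mathbb{C}[p_1,\ldots,p_n]$, where $p_i=(x_i,y_i,z_i)$, is the ideal of all polynomials that vanish on the image of $\varphi_{\mathcal{A}}$, viewed as a subset of $(\mathbb{P}^2_{\mathbb{C}})^n$ (that is, vanish at all homogeneous coordinates of every point of the image). For $\sigma=\{\sigma_1<\cdots<\sigma_k\}\subseteq\{1,\ldots,n\}$ let $$\mathcal{A}_\sigma(p)=\begin{pmatrix}A_{\sigma_1}&p_{\sigma_1}&0&\cdots&0\\ A_{\sigma_2}&0&p_{\sigma_2}&\cdots&0\\ \vdots&\vdots&&\ddots&\vdots\\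 A_{\sigma_k}&0&0&\cdots&p_{\sigma_k}\end{pmatrix},$$ a matrix of size $3k\times(4+k)$, and let the $k$-focal ideal $H^k_{\mathcal{A}}\subseteq\mathbb{C}[p_1,\ldots,p_n]$ be the ideal generated by the $(4+k)\times(4+k)$ minors of all the matrices $\mathcal{A}_\sigma(p)$ with $|\sigma|=k$. Theorem. If the foci of the cameras in $\mathcal{A}$ are pairwise distinct, then $M_{\mathcal{A}}=H^2_{\mathcal{A}}+H^3_{\mathcal{A}}$; that is, the multiview ideal is generated by the bifocal and trifocal polynomials. -/

import Mathlib

open scoped LinearAlgebra.Projectivization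

noncomputable section

namespace Multiview

/-- A (general projective) camera: a real `3 × 4` matrix of rank three. -/
structure Camera where
  mat : Matrix (Fin 3) (Fin 4) ℝ
  rank_eq : mat.rank = 3

namespace Camera

theorem finrank_ker (A : Camera) : Module.finrank ℝ (LinearMap.ker A.mat.mulVecLin) = 1 := by
  have h := LinearMap.finrank_range_add_finrank_ker A.mat.mulVecLin
  have h2 : Module.finrank ℝ (LinearMap.range A.mat.mulVecLin) = 3 := A.rank_eq
  rw [h2, Module.finrank_fin_fun] at h
  omega

/-- The focal point of a camera: the unique point of `ℙ³(ℝ)` in the kernel of its matrix. -/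
def focus (A : Camera) : ℙ ℝ (Fin 4 → ℝ) :=
  Projectivization.mk'' (LinearMap.ker A.mat.mulVecLin) A.finrank_ker

theorem mulVec_rep_ne_zero (A : Camera) {q : ℙ ℝ (Fin 4 → ℝ)} (hq : q ≠ A.focus) :
    A.mat.mulVec q.rep ≠ 0 := by
  intro h
  apply hq
  apply Projectivization.submodule_injective
  rw [focus, Projectivization.submodule_mk'']
  apply Submodule.eq_of_le_of_finrank_eq
  · rw [Projectivization.submodule_eq, Submodule.span_singleton_le_iff_mem]
    exact h
  · rw [Projectivization.finrank_submodule, A.finrank_ker]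

/-- The image `A q ∈ ℙ²(ℝ)` of a world point `q ∈ ℙ³(ℝ)` different from the focal point. -/
def image (A : Camera) (q : ℙ ℝ (Fin 4 → ℝ)) (hq : q ≠ A.focus) : ℙ ℝ (Fin 3 → ℝ) :=
  Projectivization.mk ℝ (A.mat.mulVec q.rep) (A.mulVec_rep_ne_zero hq)

end Camera

/-- The image formation map `φ_A`, from the points of `ℙ³(ℝ)` other than the foci to
`(ℙ²(ℝ))ⁿ`. -/
def imageFormation {n : ℕ} (A : Fin n → Camera)
    (q : {q : ℙ ℝ (Fin 4 → ℝ) // ∀ i, q ≠ (A i).focus}) : Fin n → ℙ ℝ (Fin 3 → ℝ) :=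
  fun i => (A i).image q.1 (q.2 i)

/-- The coordinatewise inclusion `ℝ³ → ℂ³`, semilinear over `ℝ → ℂ`. -/
def complexify : (Fin 3 → ℝ) →ₛₗ[Complex.ofRealHom] (Fin 3 → ℂ) where
  toFun v := fun a => (v a : ℂ)
  map_add' v w := by ext a; simp
  map_smul' c v := by ext a; simp

theorem complexify_injective : Function.Injective complexify := by
  intro v w h
  ext a
  exact Complex.ofReal_injective (congrFun h a)

/-- The inclusion `ℙ²(ℝ) ⊆ ℙ²(ℂ)`. -/
def complexPoint : ℙ ℝ (Fin 3 → ℝ) → ℙ ℂ (Fin 3 → ℂ) :=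
  Projectivization.map complexify complexify_injective

/-- The joint image `φ_A(ℙ³(ℝ))`, as a set of points of `(ℙ²(ℂ))ⁿ`. -/
def jointImage {n : ℕ} (A : Fin n → Camera) : Set (Fin n → ℙ ℂ (Fin 3 → ℂ)) :=
  Set.range fun q => fun i => complexPoint (imageFormation A q i)

/-- The ring `ℂ[p₁, …, pₙ]`; the variables `(i, 0), (i, 1), (i, 2)` are `xᵢ, yᵢ, zᵢ`. -/
abbrev ImageRing (n : ℕ) : Type := MvPolynomial (Fin n × Fin 3) ℂ

/-- A polynomial vanishes at a point of `(ℙ²(ℂ))ⁿ` if it vanishes at every choice of homogeneous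
coordinates of that point. -/
def VanishesAt {n : ℕ} (f : ImageRing n) (P : Fin n → ℙ ℂ (Fin 3 → ℂ)) : Prop :=
  ∀ (v : Fin n → Fin 3 → ℂ) (hv : ∀ i, v i ≠ 0),
    (∀ i, Projectivization.mk ℂ (v i) (hv i) = P i) →
      MvPolynomial.eval (fun x => v x.1 x.2) f = 0

/-- The vanishing ideal of a set of points of `(ℙ²(ℂ))ⁿ`. -/
def vanishingIdeal {n : ℕ} (S : Set (Fin n → ℙ ℂ (Fin 3 → ℂ))) : Ideal (ImageRing n) where
  carrier := {f | ∀ P ∈ S, VanishesAt f P}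
  add_mem' {f g} hf hg P hP v hv h := by
    rw [map_add, hf P hP v hv h, hg P hP v hv h, add_zero]
  zero_mem' P _ v _ _ := map_zero _
  smul_mem' c f hf P hP v hv h := by
    rw [smul_eq_mul, map_mul, hf P hP v hv h, mul_zero]

/-- The multiview ideal `M_A`: the vanishing ideal of the joint image. -/
def multiviewIdeal {n : ℕ} (A : Fin n → Camera) : Ideal (ImageRing n) :=
  vanishingIdeal (jointImage A)

/-- The partially symbolic `3k × (4 + k)` matrix `A_σ(p)`, `k = |σ|`: the block row of `i ∈ σ` has
`A_i` in the first four columns, the vector `p_i` in the column of `i`, and zeros elsewhere. -/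
def focalMatrix {n : ℕ} (A : Fin n → Camera) (σ : Finset (Fin n)) :
    Matrix (σ × Fin 3) (Fin 4 ⊕ σ) (ImageRing n) :=
  Matrix.of fun r c =>
    match c with
    | Sum.inl b => MvPolynomial.C (((A r.1).mat r.2 b : ℝ) : ℂ)
    | Sum.inr j => if r.1 = j then MvPolynomial.X ((r.1 : Fin n), r.2) else 0

/-- The ideal generated by the minors of `M` that use all columns (its maximal minors, when `M` has
at least as many rows as columns). The rows are chosen by an injection, so each minor is listed
together with its reorderings, which differ from it by a sign. -/
def maximalMinors {m c R : Type*} [Fintype c] [DecidableEq c] [CommRing R] (M : Matrix m c R) :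
    Ideal R :=
  Ideal.span (Set.range fun r : c ↪ m => (M.submatrix r id).det)

/-- The `k`-focal ideal `H_A^k`: the sum over all `k`-element sets `σ` of cameras of the ideals of
maximal minors of `A_σ(p)`. -/
def focalIdeal {n : ℕ} (A : Fin n → Camera) (k : ℕ) : Ideal (ImageRing n) :=
  ∑ σ ∈ Finset.powersetCard k (Finset.univ : Finset (Fin n)), maximalMinors (focalMatrix A σ)

end Multiview

end

open scoped LinearAlgebra.Projectivization

noncomputable section

namespace Multiview

open MvPolynomial

/-! ### Determinantal ideals -/

/-! The multiview ideal lies in the kernel of `param`, the substitution `pᵢ = λᵢ Aᵢ q`, because real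
points are Zariski dense; the focal polynomials vanish on the joint image. It remains to put every
multihomogeneous `f` of degree `d` in that kernel into `J = H² + H³`, by induction on the total
degree of `d`.

If `d i₀ > 0`, distinctness of the foci gives a plane `h = 0` through the focus of camera `i₀` and
no other focus. On this plane every other camera is an isomorphism onto its image plane and camera
`i₀` is a projection to a line. In suitable coordinates (`AdaptedFrame`) the restricted
parametrization is monomial, `p_{i,a} ↦ λᵢ q_a`, except that `z = p_{i₀,2} ↦ 0`. Its kernel is
governed by the 2 × 2 minors of the matrix of variables without that entry. Modulo `z`, minors
through row `i₀` are bifocal (`bifocal_mem`); the others, multiplied by an entry of row `i₀`, are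
trifocal (`trifocal_mem`). The extra factor costs nothing, since every monomial of degree `d`
contains a variable of row `i₀` (`mem_of_toricMap_eq_zero`).

Hence `f = j + g z` with `j ∈ J`. As `param` sends `z` to `λ_{i₀} h ≠ 0` in a domain, it kills the
relevant component of `g`, which has smaller degree. -/

theorem det_mul_mem_maximalMinors {m c R : Type*} [Fintype m] [DecidableEq m] [Fintype c]
    [DecidableEq c] [CommRing R] (N : Matrix c m R) (M : Matrix m c R) :
    (N * M).det ∈ maximalMinors M := by
  have h : (N * M).det = ∑ r : c → m, (∏ x, N x (r x)) * (M.submatrix r id).det := by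
    have h1 : (N * M) = fun x => ∑ k, N x k • M k := by
      ext x y
      simp [Matrix.mul_apply]
    have h2 := (Matrix.detRowAlternating (n := c) (R := R)).toMultilinearMap.map_sum
      (fun x k => N x k • M k)
    have h3 : (N * M).det = Matrix.detRowAlternating.toMultilinearMap
        (fun x => ∑ k, N x k • M k) := by
      rw [h1]; rfl
    rw [h3, h2]
    refine Finset.sum_congr rfl fun r _ => ?_
    exact MultilinearMap.map_smul_univ _ (fun x => N x (r x)) (fun x => M (r x))
  rw [h]
  refine Ideal.sum_mem _ fun r _ => Ideal.mul_mem_left _ _ ?_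
  -- After multilinear expansion in the rows, a non-injective choice of rows repeats a row and
  -- contributes zero.
  by_cases hr : Function.Injective r
  · exact Ideal.subset_span ⟨⟨r, hr⟩, rfl⟩
  · simp only [Function.Injective, not_forall] at hr
    obtain ⟨x, y, hxy, hne⟩ := hr
    rw [Matrix.det_zero_of_row_eq hne]
    · exact Ideal.zero_mem _
    · ext z
      simp [hxy]

/-- The lower left block repeats rows of `G`, so row subtraction clears it. The factorization below
achieves this without inverting `G`. -/
theorem det_fromBlocks_submatrix {k l R : Type*} [Fintype k] [DecidableEq k] [Fintype l]
    [DecidableEq l] [CommRing R] (G : Matrix k k R) (B : Matrix k l R) (e : l → k)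
    (D : Matrix l l R) :
    (Matrix.fromBlocks G B (G.submatrix e id) D).det = (D - B.submatrix e id).det * G.det := by
  have h : Matrix.fromBlocks G B (G.submatrix e id) D =
      Matrix.fromBlocks 1 B ((1 : Matrix k k R).submatrix e id) D *
        Matrix.fromBlocks G 0 0 1 := by
    rw [Matrix.fromBlocks_multiply]
    congr 1 <;> ext x y <;> simp [Matrix.mul_apply, Matrix.one_apply]
  rw [h, Matrix.det_mul, Matrix.det_fromBlocks_one₁₁]
  congr 1
  · congr 2
    ext x y
    simp [Matrix.mul_apply, Matrix.one_apply]
  · simp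

/-! ### Focal polynomials from linear relations among camera rows -/

variable {n : ℕ}

/-- The complexification of the matrix of a camera. -/
def Camera.cmat (A : Camera) : Matrix (Fin 3) (Fin 4) ℂ := A.mat.map (fun x : ℝ => (x : ℂ))

/-- The linear form `r ⬝ pᵢ` in the coordinates of the `i`-th image. -/
def imageForm (i : Fin n) : (Fin 3 → ℂ) →ₗ[ℂ] ImageRing n where
  toFun r := ∑ a, C (r a) * X (i, a)
  map_add' r s := by simp [add_mul, Finset.sum_add_distrib]
  map_smul' c r := by simp [Finset.smul_sum, MvPolynomial.smul_eq_C_mul, mul_assoc]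

theorem imageForm_apply (i : Fin n) (r : Fin 3 → ℂ) :
    imageForm i r = ∑ a, C (r a) * X (i, a) := rfl

theorem maximalMinors_le_focalIdeal (A : Fin n → Camera) {k : ℕ} (σ : Finset (Fin n))
    (hσ : σ.card = k) : maximalMinors (focalMatrix A σ) ≤ focalIdeal A k := by
  unfold focalIdeal
  rw [Ideal.sum_eq_sup]
  exact Finset.le_sup (f := fun σ => maximalMinors (focalMatrix A σ))
    (Finset.mem_powersetCard_univ.2 hσ)

/-- Each row is a constant combination of rows of the focal matrix, with coefficients `W x l` on the
block of camera `s l`; the matrix is thus a product `N * focalMatrix A σ`. -/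
theorem det_rows_mem_focalIdeal (A : Fin n → Camera) {k : ℕ} (s : Fin k → Fin n)
    (hs : Function.Injective s) (W : Fin 4 ⊕ Fin k → Fin k → Fin 3 → ℂ) :
    (Matrix.of fun x => Sum.elim
      (fun b => C ((∑ l, Matrix.vecMul (W x l) (A (s l)).cmat) b))
      (fun l => imageForm (s l) (W x l)) : Matrix (Fin 4 ⊕ Fin k) (Fin 4 ⊕ Fin k)
        (ImageRing n)).det ∈ focalIdeal A k := by
  classical
  let σ : Finset (Fin n) := Finset.univ.map ⟨s, hs⟩
  have hσ : σ.card = k := by simp [σ]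
  let e : Fin k ≃ σ := Equiv.ofBijective (fun l => ⟨s l, by simp [σ]⟩) (by
    constructor
    · intro a b hab
      exact hs (congrArg Subtype.val hab)
    · rintro ⟨x, hx⟩
      obtain ⟨l, -, rfl⟩ := Finset.mem_map.1 hx
      exact ⟨l, rfl⟩)
  have he : ∀ l, (e l : Fin n) = s l := fun _ => rfl
  let E : Fin 4 ⊕ Fin k ≃ Fin 4 ⊕ σ := Equiv.sumCongr (Equiv.refl _) e
  let N : Matrix (Fin 4 ⊕ σ) (σ × Fin 3) (ImageRing n) :=
    Matrix.of fun x r => C (W (E.symm x) (e.symm r.1) r.2)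
  apply maximalMinors_le_focalIdeal A σ hσ
  convert det_mul_mem_maximalMinors N (focalMatrix A σ) using 1
  rw [← Matrix.det_submatrix_equiv_self E]
  congr 1
  ext1 x y
  have hx : ∀ l a, N (E x) (e l, a) = C (W x l a) := by
    intro l a; simp [N]
  rw [Matrix.submatrix_apply, Matrix.mul_apply, Fintype.sum_prod_type, ← e.sum_comp]
  simp only [hx]
  rcases y with b | l
  · simp only [E, Equiv.sumCongr_apply, Sum.map_inl, Equiv.refl_apply, Matrix.of_apply,
      Sum.elim_inl, focalMatrix, Finset.sum_apply, map_sum]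
    refine Finset.sum_congr rfl fun l _ => ?_
    simp [Matrix.vecMul, dotProduct, Camera.cmat, he]
  · simp only [E, Equiv.sumCongr_apply, Sum.map_inr, Matrix.of_apply,
      Sum.elim_inr, focalMatrix, imageForm_apply, EmbeddingLike.apply_eq_iff_eq]
    rw [Finset.sum_eq_single l]
    · simp [he]
    · intro l' _ hl'
      simp [hl']
    · simp

/-- Linear relations among the rows of the cameras give elements of the focal ideals. -/
theorem det_sub_mem_focalIdeal (A : Fin n → Camera) {k : ℕ} (s : Fin k → Fin n)
    (hs : Function.Injective s) (G : Matrix (Fin 4) (Fin 4) ℂ) (hG : IsUnit G.det) (e : Fin k → Fin 4)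
    (T : Fin 4 → Fin k → Fin 3 → ℂ) (S : Fin k → Fin k → Fin 3 → ℂ)
    (hT : ∀ x, ∑ l, Matrix.vecMul (T x l) (A (s l)).cmat = G x)
    (hS : ∀ y, ∑ l, Matrix.vecMul (S y l) (A (s l)).cmat = G (e y)) :
    (Matrix.of fun y l => imageForm (s l) (S y l) - imageForm (s l) (T (e y) l)).det ∈
      focalIdeal A k := by
  have h := det_rows_mem_focalIdeal A s hs (Sum.elim T S)
  have hM : (Matrix.of fun x => Sum.elim
      (fun b => C ((∑ l, Matrix.vecMul (Sum.elim T S x l) (A (s l)).cmat) b))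
      (fun l => imageForm (s l) (Sum.elim T S x l)) : Matrix (Fin 4 ⊕ Fin k) (Fin 4 ⊕ Fin k)
        (ImageRing n)) =
      Matrix.fromBlocks (G.map C) (Matrix.of fun x l => imageForm (s l) (T x l))
        ((G.map C).submatrix e id) (Matrix.of fun y l => imageForm (s l) (S y l)) := by
    ext1 x y
    rcases x with x | x <;> rcases y with y | y <;>
      simp only [Matrix.of_apply, Sum.elim_inl, Sum.elim_inr, Matrix.fromBlocks_apply₁₁,
        Matrix.fromBlocks_apply₁₂, Matrix.fromBlocks_apply₂₁, Matrix.fromBlocks_apply₂₂,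
        Matrix.map_apply, Matrix.submatrix_apply, id, hT, hS]
  rw [hM, det_fromBlocks_submatrix] at h
  have hu : IsUnit (G.map (C : ℂ → ImageRing n)).det := by
    have : (G.map (C : ℂ → ImageRing n)).det = C G.det := by
      rw [RingHom.map_det]; rfl
    rw [this]
    exact hG.map _
  rw [Ideal.mul_unit_mem_iff_mem _ hu] at h
  exact h

/-- Coordinates adapted to a plane through the focus of the camera `i₀` and through no other focus.
The rows of `G` are linear forms on the world, the last of which cuts out the plane, and the rows
of `P i` are linear forms on the `i`-th image. -/
structure AdaptedFrame (A : Fin n → Camera) (i₀ : Fin n) where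
  G : Matrix (Fin 4) (Fin 4) ℂ
  isUnit_det_G : IsUnit G.det
  P : Fin n → Matrix (Fin 3) (Fin 3) ℂ
  isUnit_det_P : ∀ i, IsUnit (P i).det
  α : Fin n → Fin 3 → ℂ
  vecMul_of_ne : ∀ i, i ≠ i₀ → ∀ a,
    Matrix.vecMul (P i a) (A i).cmat = G a.castSucc + α i a • G (Fin.last 3)
  vecMul_zero : Matrix.vecMul (P i₀ 0) (A i₀).cmat = G 0
  vecMul_one : Matrix.vecMul (P i₀ 1) (A i₀).cmat = G 1
  vecMul_two : Matrix.vecMul (P i₀ 2) (A i₀).cmat = G (Fin.last 3)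

/-! ### Ladder minors from bifocal and trifocal polynomials -/

namespace AdaptedFrame

variable {A : Fin n → Camera} {i₀ : Fin n} (F : AdaptedFrame A i₀)

/-- The image coordinates of an adapted frame. -/
def coord (x : Fin n × Fin 3) : ImageRing n := imageForm x.1 (F.P x.1 x.2)

/-- The forms `G 0` and `G 1` are seen exactly by camera `i₀`, and by camera `i` up to a multiple of
the last form, which camera `i₀` sees as its coordinate 2. These two relations give a 2 × 2
determinant that equals the minor up to sign modulo that coordinate. -/
theorem bifocal_mem {i : Fin n} (hi : i ≠ i₀) :
    F.coord (i, 0) * F.coord (i₀, 1) - F.coord (i, 1) * F.coord (i₀, 0) ∈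
      focalIdeal A 2 ⊔ Ideal.span {F.coord (i₀, 2)} := by
  have hs : Function.Injective ![i, i₀] := by
    intro a b; fin_cases a <;> fin_cases b <;> simp [hi, hi.symm]
  have key := det_sub_mem_focalIdeal A _ hs F.G F.isUnit_det_G ![0, 1]
    (Fin.snoc (α := fun _ => Fin 2 → Fin 3 → ℂ)
      (fun a => ![F.P i a, -(F.α i a • F.P i₀ 2)]) ![0, F.P i₀ 2])
    ![![0, F.P i₀ 0], ![0, F.P i₀ 1]]
    (by
      intro x
      refine Fin.lastCases ?_ (fun a => ?_) x
      · simp only [Fin.snoc_last]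
        simp [F.vecMul_two]
      · simp [F.vecMul_two, F.vecMul_of_ne i hi, Matrix.neg_vecMul, Matrix.smul_vecMul])
    (by
      intro y
      fin_cases y <;> simp [F.vecMul_zero, F.vecMul_one])
  have h0 : ∀ f : Fin 3 → Fin 2 → Fin 3 → ℂ, ∀ g,
      (Fin.snoc (α := fun _ => Fin 2 → Fin 3 → ℂ) f g : Fin 4 → _) 0 = f 0 := fun f g => rfl
  have h1 : ∀ f : Fin 3 → Fin 2 → Fin 3 → ℂ, ∀ g,
      (Fin.snoc (α := fun _ => Fin 2 → Fin 3 → ℂ) f g : Fin 4 → _) 1 = f 1 := fun f g => rfl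
  rw [Matrix.det_fin_two] at key
  simp only [Matrix.of_apply, Matrix.cons_val_zero,
    Matrix.cons_val_one, h0, h1, map_zero, map_neg, map_smul, zero_sub] at key
  rw [Submodule.mem_sup]
  refine ⟨_, neg_mem key, (MvPolynomial.C (F.α i 0) * F.coord (i, 1) -
    MvPolynomial.C (F.α i 1) * F.coord (i, 0)) * F.coord (i₀, 2),
    Ideal.mul_mem_left _ _ (Ideal.mem_span_singleton_self _), ?_⟩
  simp only [coord, MvPolynomial.smul_eq_C_mul]
  ring

/-- Forms `a` and `b` are compared between cameras `i` and `j`, form `c` between `i` and `i₀`.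
Modulo coordinate 2 of `i₀`, the column of `i₀` has a single nonzero entry, `F.coord (i₀, c)`. The
case `c = 2` is excluded because camera `i₀` sees `G 0`, `G 1`, `G 3` but not `G 2`. -/
theorem trifocal_mem {i j : Fin n} (hi : i ≠ i₀) (hj : j ≠ i₀) (hij : i ≠ j) (a b c : Fin 3)
    (hc : c ≠ 2) :
    F.coord (i₀, c) * (F.coord (i, a) * F.coord (j, b) - F.coord (i, b) * F.coord (j, a)) ∈
      focalIdeal A 3 ⊔ Ideal.span {F.coord (i₀, 2)} := by
  have hs : Function.Injective ![i, j, i₀] := by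
    intro a b; fin_cases a <;> fin_cases b <;> simp [hi, hi.symm, hj, hj.symm, hij, hij.symm]
  have hc' : Matrix.vecMul (F.P i₀ c) (A i₀).cmat = F.G c.castSucc := by
    fin_cases c
    · exact F.vecMul_zero
    · exact F.vecMul_one
    · exact absurd rfl hc
  have key := det_sub_mem_focalIdeal A _ hs F.G F.isUnit_det_G
    ![a.castSucc, b.castSucc, c.castSucc]
    (Fin.snoc (α := fun _ => Fin 3 → Fin 3 → ℂ)
      (fun a => ![F.P i a, 0, -(F.α i a • F.P i₀ 2)]) ![0, 0, F.P i₀ 2])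
    ![![0, F.P j a, -(F.α j a • F.P i₀ 2)], ![0, F.P j b, -(F.α j b • F.P i₀ 2)],
      ![0, 0, F.P i₀ c]]
    (by
      intro x
      refine Fin.lastCases ?_ (fun a => ?_) x
      · simp only [Fin.snoc_last]
        simp [F.vecMul_two, Fin.sum_univ_three]
      · simp [F.vecMul_two, F.vecMul_of_ne i hi, Matrix.neg_vecMul, Matrix.smul_vecMul,
          Fin.sum_univ_three])
    (by
      intro y
      fin_cases y <;> simp [hc', F.vecMul_of_ne j hj, F.vecMul_two, Matrix.neg_vecMul,
        Matrix.smul_vecMul, Fin.sum_univ_three])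
  rw [Matrix.det_fin_three] at key
  simp only [Matrix.of_apply, Matrix.cons_val_zero,
    Matrix.cons_val_one, Matrix.cons_val, Fin.snoc_castSucc, map_zero, map_neg, map_smul,
    zero_sub] at key
  rw [Submodule.mem_sup]
  refine ⟨_, neg_mem key, (
    - (C (F.α i c) * (F.coord (i, a) * F.coord (j, b) - F.coord (i, b) * F.coord (j, a))
    + C (F.α i a - F.α j a) * F.coord (j, b) * F.coord (i, c) * (-1)
    + C (F.α i b - F.α j b) * F.coord (j, a) * F.coord (i, c))) * F.coord (i₀, 2),
    Ideal.mul_mem_left _ _ (Ideal.mem_span_singleton_self _), ?_⟩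
  simp only [coord, MvPolynomial.smul_eq_C_mul, map_sub]
  ring

end AdaptedFrame

/-! ### Existence of adapted frames -/

theorem Camera.mulVec_focus_rep (A : Camera) : A.mat.mulVec A.focus.rep = 0 := by
  have h : A.focus.rep ∈ A.focus.submodule := by
    rw [Projectivization.submodule_eq]
    exact Submodule.mem_span_singleton_self _
  rwa [focus, Projectivization.submodule_mk''] at h

theorem Camera.exists_smul_focus_rep (A : Camera) {v : Fin 4 → ℝ} (hv : A.mat.mulVec v = 0) :
    ∃ t : ℝ, t • A.focus.rep = v := by
  have h : v ∈ A.focus.submodule := by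
    rw [focus, Projectivization.submodule_mk'']
    exact hv
  rw [Projectivization.submodule_eq] at h
  exact Submodule.mem_span_singleton.1 h

theorem Camera.vecMul_injective (A : Camera) :
    Function.Injective fun v => Matrix.vecMul v A.mat := by
  have h := A.rank_eq
  rw [Matrix.rank_eq_finrank_span_row] at h
  have h2 : LinearIndependent ℝ A.mat.row := by
    rw [linearIndependent_iff_card_eq_finrank_span, Set.finrank, h]
    rfl
  exact Matrix.vecMul_injective_iff.2 h2

/-- A plane through the focus of `A i₀` and through no other focus, given by a linear form on the
`i₀`-th image. -/
theorem exists_plane (A : Fin n → Camera)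
    (hA : Pairwise fun i j => (A i).focus ≠ (A j).focus) (i₀ : Fin n) :
    ∃ r : Fin 3 → ℝ, r ≠ 0 ∧ ∀ i, i ≠ i₀ →
      Matrix.vecMul r (A i₀).mat ⬝ᵥ (A i).focus.rep ≠ 0 := by
  classical
  -- The form must avoid the images of the other foci under camera `i₀`. The dummy vector at `i₀`
  -- forces it to be nonzero even if there is no other camera.
  obtain ⟨f, hf⟩ := Module.exists_dual_forall_apply_ne_zero (K := ℝ)
    (fun i => if i = i₀ then Pi.single 0 1 else (A i₀).mat.mulVec (A i).focus.rep) (by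
      intro i
      by_cases h : i = i₀
      · simp [h]
      · simpa only [if_neg h] using (A i₀).mulVec_rep_ne_zero (hA h))
  have hr : ∀ v, f v = (fun i => f fun j => if i = j then 1 else 0) ⬝ᵥ v := by
    intro v
    rw [LinearMap.pi_apply_eq_sum_univ f v, dotProduct]
    exact Finset.sum_congr rfl fun i _ => mul_comm _ _
  refine ⟨fun i => f fun j => if i = j then 1 else 0, ?_, ?_⟩
  · intro h0
    apply hf i₀
    rw [hr, h0, zero_dotProduct]
  · intro i hi
    have := hf i
    rw [if_neg hi, hr] at this
    rwa [← Matrix.dotProduct_mulVec]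

theorem exists_isUnit_det_row_two {r : Fin 3 → ℝ} (hr : r ≠ 0) :
    ∃ P : Matrix (Fin 3) (Fin 3) ℝ, IsUnit P.det ∧ P 2 = r := by
  obtain ⟨x, hx⟩ := exists_linearIndependent_cons_of_lt_finrank
    (R := ℝ) (v := ![r]) (LinearIndependent.of_subsingleton 0 hr) (by simp)
  obtain ⟨y, hy⟩ := exists_linearIndependent_cons_of_lt_finrank hx (by simp)
  refine ⟨Matrix.of (Fin.cons y (Fin.cons x ![r])), ?_, rfl⟩
  rw [← Matrix.isUnit_iff_isUnit_det]
  exact Matrix.linearIndependent_rows_iff_isUnit.1 hy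

theorem exists_isUnit_det_rows {g : Fin 3 → Fin 4 → ℝ} (hg : LinearIndependent ℝ g) :
    ∃ G : Matrix (Fin 4) (Fin 4) ℝ, IsUnit G.det ∧ G 0 = g 0 ∧ G 1 = g 1 ∧ G (Fin.last 3) = g 2 := by
  obtain ⟨x, hx⟩ := exists_linearIndependent_cons_of_lt_finrank hg (by simp)
  -- The reordering places the new vector `x` in row 2, the form that camera `i₀` does not see.
  refine ⟨Matrix.of fun b => (Fin.cons x g : Fin 4 → Fin 4 → ℝ) (![1, 2, 0, 3] b), ?_, rfl, rfl, rfl⟩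
  rw [← Matrix.isUnit_iff_isUnit_det]
  exact Matrix.linearIndependent_rows_iff_isUnit.1 (hx.comp ![1, 2, 0, 3] (by decide))

/-- The rows of a camera together with a plane not through its focus span all linear forms. -/
theorem Camera.exists_vecMul_add_smul (A : Camera) {h : Fin 4 → ℝ} (hh : h ⬝ᵥ A.focus.rep ≠ 0)
    (g : Fin 4 → ℝ) : ∃ (r : Fin 3 → ℝ) (t : ℝ), Matrix.vecMul r A.mat = g + t • h := by
  let N : Matrix (Fin 4) (Fin 4) ℝ :=
    Matrix.of (Fin.snoc (α := fun _ => Fin 4 → ℝ) (fun a => A.mat a) h)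
  have hN1 : ∀ a : Fin 3, N a.castSucc = A.mat a := fun a => by
    change (Fin.snoc (α := fun _ => Fin 4 → ℝ) (fun a => A.mat a) h : Fin 4 → Fin 4 → ℝ) _ = _
    rw [Fin.snoc_castSucc]
  have hN2 : N (Fin.last 3) = h := by
    change (Fin.snoc (α := fun _ => Fin 4 → ℝ) (fun a => A.mat a) h : Fin 4 → Fin 4 → ℝ)
      (Fin.last 3) = h
    rw [Fin.snoc_last]
  have hN : IsUnit N := by
    rw [← Matrix.mulVec_injective_iff_isUnit, ← Matrix.coe_mulVecLin, ← LinearMap.ker_eq_bot,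
      Matrix.ker_mulVecLin_eq_bot_iff]
    intro v hv
    have h1 : A.mat.mulVec v = 0 := by
      ext a
      have := congrFun hv a.castSucc
      simpa only [Matrix.mulVec, hN1, Pi.zero_apply] using this
    obtain ⟨t, rfl⟩ := A.exists_smul_focus_rep h1
    have h2 : h ⬝ᵥ (t • A.focus.rep) = 0 := by
      have := congrFun hv (Fin.last 3)
      simpa only [Matrix.mulVec, hN2, Pi.zero_apply] using this
    rw [dotProduct_smul, smul_eq_mul, mul_eq_zero, or_iff_left hh] at h2
    rw [h2, zero_smul]
  obtain ⟨w, hw⟩ := Matrix.vecMul_surjective_iff_isUnit.2 hN g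
  refine ⟨fun a => w a.castSucc, -w (Fin.last 3), ?_⟩
  rw [← hw]
  ext b
  simp only [Matrix.vecMul, dotProduct, Fin.sum_univ_castSucc (n := 3), Pi.add_apply,
    Pi.smul_apply, smul_eq_mul, hN1, hN2]
  ring

/-- A relation `x P = 0`, multiplied by `M`, becomes a relation among the independent rows of `G`
with coefficients `x` and `x ⬝ᵥ α`. -/
theorem isUnit_det_of_vecMul_eq {P : Matrix (Fin 3) (Fin 3) ℝ} {M : Matrix (Fin 3) (Fin 4) ℝ}
    {G : Matrix (Fin 4) (Fin 4) ℝ} (hG : IsUnit G.det) {α : Fin 3 → ℝ}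
    (h : ∀ a, Matrix.vecMul (P a) M = G a.castSucc + α a • G (Fin.last 3)) : IsUnit P.det := by
  rw [← Matrix.isUnit_iff_isUnit_det] at hG ⊢
  rw [← Matrix.vecMul_injective_iff_isUnit] at hG ⊢
  have key : ∀ x, Matrix.vecMul x P = 0 → x = 0 := by
    intro x hx
    have h1 : Matrix.vecMul (Fin.snoc (α := fun _ => ℝ) x (x ⬝ᵥ α)) G = 0 := by
      have h2 : Matrix.vecMul (Matrix.vecMul x P) M = 0 := by rw [hx, Matrix.zero_vecMul]
      rw [Matrix.vecMul_vecMul] at h2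
      rw [← h2]
      ext b
      have h3 : ∀ a, (P * M) a b = G a.castSucc b + α a * G (Fin.last 3) b := by
        intro a
        have := congrFun (h a) b
        simpa [Matrix.mul_apply_eq_vecMul] using this
      simp only [Matrix.vecMul, dotProduct, Fin.sum_univ_castSucc (n := 3), Fin.snoc_castSucc,
        Fin.snoc_last, h3, mul_add, Finset.sum_add_distrib, Finset.sum_mul, mul_assoc]
    have h4 := hG (h1.trans (Matrix.zero_vecMul G).symm)
    ext a
    have := congrFun h4 a.castSucc
    simpa using this
  intro x y hxy
  have := key (x - y) (by rw [Matrix.sub_vecMul]; exact sub_eq_zero.2 hxy)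
  exact sub_eq_zero.1 this

theorem exists_adaptedFrame (A : Fin n → Camera)
    (hA : Pairwise fun i j => (A i).focus ≠ (A j).focus) (i₀ : Fin n) :
    Nonempty (AdaptedFrame A i₀) := by
  classical
  obtain ⟨r, hr0, hr⟩ := exists_plane A hA i₀
  obtain ⟨P₀, hP₀, hP₀r⟩ := exists_isUnit_det_row_two hr0
  have hind : LinearIndependent ℝ (fun a => Matrix.vecMul (P₀ a) (A i₀).mat) := by
    rw [← Matrix.isUnit_iff_isUnit_det, ← Matrix.linearIndependent_rows_iff_isUnit] at hP₀
    exact hP₀.map' (A i₀).mat.vecMulLinear (LinearMap.ker_eq_bot.2 (A i₀).vecMul_injective)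
  obtain ⟨G, hG, hG0, hG1, hG3⟩ := exists_isUnit_det_rows hind
  have hh : ∀ i, i ≠ i₀ → G (Fin.last 3) ⬝ᵥ (A i).focus.rep ≠ 0 := by
    intro i hi
    rw [hG3, hP₀r]
    exact hr i hi
  have hex : ∀ i, ∃ (P : Matrix (Fin 3) (Fin 3) ℝ) (α : Fin 3 → ℝ), i ≠ i₀ →
      ∀ a, Matrix.vecMul (P a) (A i).mat = G a.castSucc + α a • G (Fin.last 3) := by
    intro i
    by_cases hi : i = i₀
    · exact ⟨0, 0, fun h => absurd hi h⟩
    · choose P α h using fun a : Fin 3 =>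
        (A i).exists_vecMul_add_smul (hh i hi) (G a.castSucc)
      exact ⟨P, α, fun _ => h⟩
  choose P α hP using hex
  have hdet : ∀ {m : ℕ} (M : Matrix (Fin m) (Fin m) ℝ), IsUnit M.det →
      IsUnit (M.map (fun x : ℝ => (x : ℂ))).det := by
    intro m M hM
    have : (M.map (fun x : ℝ => (x : ℂ))).det = Complex.ofRealHom M.det := by
      rw [RingHom.map_det]; rfl
    rw [this]
    exact hM.map _
  have hvec : ∀ (v : Fin 3 → ℝ) (B : Camera) (g : Fin 4 → ℝ), Matrix.vecMul v B.mat = g →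
      Matrix.vecMul (fun a => (v a : ℂ)) B.cmat = fun b => (g b : ℂ) := by
    rintro v B g rfl
    ext b
    exact (RingHom.map_vecMul Complex.ofRealHom B.mat v b).symm
  refine ⟨{
    G := G.map (fun x : ℝ => (x : ℂ))
    isUnit_det_G := hdet G hG
    P := fun i => (if i = i₀ then P₀ else P i).map (fun x : ℝ => (x : ℂ))
    isUnit_det_P := fun i => ?_
    α := fun i a => (α i a : ℂ)
    vecMul_of_ne := fun i hi a => ?_
    vecMul_zero := ?_
    vecMul_one := ?_
    vecMul_two := ?_ }⟩
  · by_cases hi : i = i₀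
    · simpa only [if_pos hi] using hdet _ hP₀
    · simpa only [if_neg hi] using hdet _ (isUnit_det_of_vecMul_eq hG (hP i hi))
  · simp only [if_neg hi]
    refine (hvec _ _ _ (hP i hi a)).trans ?_
    ext b
    simp
  · simp only [if_true]
    exact hvec _ _ _ hG0.symm
  · simp only [if_true]
    exact hvec _ _ _ hG1.symm
  · simp only [if_true]
    exact hvec _ _ _ hG3.symm

/-! ### The toric ideal of a matrix of variables without one entry -/

section Toric

variable {ι : Type*}

/-- The multidegree of an exponent with respect to the rows. -/
def rowSum (m : ι × Fin 3 →₀ ℕ) : ι →₀ ℕ := m.mapDomain Prod.fst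

/-- The multidegree of an exponent with respect to the columns. -/
def colSum (m : ι × Fin 3 →₀ ℕ) : Fin 3 →₀ ℕ := m.mapDomain Prod.snd

@[simp] theorem rowSum_add (m m' : ι × Fin 3 →₀ ℕ) : rowSum (m + m') = rowSum m + rowSum m' :=
  Finsupp.mapDomain_add

@[simp] theorem colSum_add (m m' : ι × Fin 3 →₀ ℕ) : colSum (m + m') = colSum m + colSum m' :=
  Finsupp.mapDomain_add

@[simp] theorem rowSum_single (i : ι) (a : Fin 3) (k : ℕ) :
    rowSum (Finsupp.single (i, a) k) = Finsupp.single i k := Finsupp.mapDomain_single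

@[simp] theorem colSum_single (i : ι) (a : Fin 3) (k : ℕ) :
    colSum (Finsupp.single (i, a) k) = Finsupp.single a k := Finsupp.mapDomain_single

theorem exists_eq_single_add {σ : Type*} {m : σ →₀ ℕ} {x : σ} (h : m x ≠ 0) :
    ∃ m', m = Finsupp.single x 1 + m' :=
  ⟨m - Finsupp.single x 1, by
    rw [add_tsub_cancel_of_le]
    exact Finsupp.single_le_iff.2 (Nat.one_le_iff_ne_zero.2 h)⟩

theorem exists_ne_zero_of_mapDomain {σ τ : Type*} {m : σ →₀ ℕ} {f : σ → τ} {y : τ}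
    (h : m.mapDomain f y ≠ 0) : ∃ x, f x = y ∧ m x ≠ 0 := by
  classical
  have h1 := Finsupp.mapDomain_support (Finsupp.mem_support_iff.2 h)
  obtain ⟨x, hx, rfl⟩ := Finset.mem_image.1 h1
  exact ⟨x, rfl, Finsupp.mem_support_iff.1 hx⟩

theorem exists_eq_single_add_of_rowSum {m : ι × Fin 3 →₀ ℕ} {i : ι} (h : rowSum m i ≠ 0) :
    ∃ a m', m = Finsupp.single (i, a) 1 + m' := by
  obtain ⟨⟨_, a⟩, rfl, hx⟩ := exists_ne_zero_of_mapDomain h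
  exact ⟨a, exists_eq_single_add hx⟩

theorem exists_eq_single_add_of_colSum {m : ι × Fin 3 →₀ ℕ} {a : Fin 3} (h : colSum m a ≠ 0) :
    ∃ i m', m = Finsupp.single (i, a) 1 + m' := by
  obtain ⟨⟨i, _⟩, rfl, hx⟩ := exists_ne_zero_of_mapDomain h
  exact ⟨i, exists_eq_single_add hx⟩

theorem rowSum_apply_ne_zero {m : ι × Fin 3 →₀ ℕ} {i : ι} {a : Fin 3} (h : m (i, a) ≠ 0) :
    rowSum m i ≠ 0 := by
  obtain ⟨m', rfl⟩ := exists_eq_single_add h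
  simp

/-- An ideal that contains the two-by-two minors of the matrix of variables without the entry
`(i₀, 2)`, those that avoid the row `i₀` only after multiplication with an entry of that row. -/
structure ContainsLadderMinors {R : Type*} [CommRing R] (K : Ideal (MvPolynomial (ι × Fin 3) R))
    (i₀ : ι) : Prop where
  bifocal : ∀ i, i ≠ i₀ → X (i, 0) * X (i₀, 1) - X (i, 1) * X (i₀, 0) ∈ K
  trifocal : ∀ i j, i ≠ i₀ → j ≠ i₀ → i ≠ j → ∀ a b c, c ≠ 2 →
    X (i₀, c) * (X (i, a) * X (j, b) - X (i, b) * X (j, a)) ∈ K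

variable {R : Type*} [CommRing R] {K : Ideal (MvPolynomial (ι × Fin 3) R)} {i₀ : ι}

/-- If `j ≠ i₀`, the variable of row `i₀` needed by the trifocal relation must come from `m`; `hm`
ensures that it is not the removed entry. -/
theorem ContainsLadderMinors.swap_mem (hK : ContainsLadderMinors K i₀) {i j : ι} {a b : Fin 3}
    {m : ι × Fin 3 →₀ ℕ} (hi : i ≠ i₀) (hij : i ≠ j) (hj : j = i₀ → a ≠ 2 ∧ b ≠ 2)
    (hm : m (i₀, 2) = 0)
    (hrow : rowSum (Finsupp.single (i, a) 1 + (Finsupp.single (j, b) 1 + m)) i₀ ≠ 0) :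
    monomial (Finsupp.single (i, a) 1 + (Finsupp.single (j, b) 1 + m)) (1 : R) -
      monomial (Finsupp.single (i, b) 1 + (Finsupp.single (j, a) 1 + m)) 1 ∈ K := by
  have hmul : ∀ (x : ι × Fin 3) (m : ι × Fin 3 →₀ ℕ),
      monomial (Finsupp.single x 1 + m) (1 : R) = X x * monomial m 1 := by
    intro x m
    rw [X, monomial_mul, one_mul]
  by_cases hji : j = i₀
  · obtain ⟨ha, hb⟩ := hj hji
    subst hji
    have key := Ideal.mul_mem_left K (monomial m 1) (hK.bifocal i hi)
    simp only [hmul]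
    obtain rfl | ⟨rfl, rfl⟩ | ⟨rfl, rfl⟩ : a = b ∨ (a = 0 ∧ b = 1) ∨ (a = 1 ∧ b = 0) := by
      revert ha hb; fin_cases a <;> fin_cases b <;> simp
    · simp
    · convert key using 1; ring
    · convert neg_mem key using 1; ring
  · have h0 : rowSum m i₀ ≠ 0 := by
      simpa [hi, hji, Finsupp.single_apply] using hrow
    obtain ⟨c, m', rfl⟩ := exists_eq_single_add_of_rowSum h0
    have hc : c ≠ 2 := by
      rintro rfl
      simp at hm
    have key := Ideal.mul_mem_left K (monomial m' 1) (hK.trifocal i j hi hji hij a b c hc)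
    simp only [hmul]
    convert key using 1
    ring

/-- By swaps, the two monomials are made to share a variable outside row `i₀`, which is then
cancelled. The degree drops while the degree in row `i₀` stays positive. -/
theorem ContainsLadderMinors.monomial_sub_mem (hK : ContainsLadderMinors K i₀)
    {m m' : ι × Fin 3 →₀ ℕ} (hrow : rowSum m = rowSum m') (hcol : colSum m = colSum m')
    (hm : m (i₀, 2) = 0) (hm' : m' (i₀, 2) = 0) (h₀ : rowSum m i₀ ≠ 0) :
    monomial m (1 : R) - monomial m' 1 ∈ K := by
  classical
  induction hN : m.degree using Nat.strong_induction_on generalizing m m' with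
  | _ N ih =>
  have shared : ∀ (i : ι) (a : Fin 3) (p p' : ι × Fin 3 →₀ ℕ), i ≠ i₀ →
      (Finsupp.single (i, a) 1 + p).degree = N →
      rowSum (Finsupp.single (i, a) 1 + p) = rowSum (Finsupp.single (i, a) 1 + p') →
      colSum (Finsupp.single (i, a) 1 + p) = colSum (Finsupp.single (i, a) 1 + p') →
      p (i₀, 2) = 0 → p' (i₀, 2) = 0 → rowSum (Finsupp.single (i, a) 1 + p) i₀ ≠ 0 →
      monomial (Finsupp.single (i, a) 1 + p) (1 : R) -
        monomial (Finsupp.single (i, a) 1 + p') 1 ∈ K := by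
    intro i a p p' hi hdeg hr hc hp hp' h0
    have h1 : monomial p (1 : R) - monomial p' 1 ∈ K := by
      refine ih p.degree ?_ ?_ ?_ hp hp' ?_ rfl
      · rw [← hdeg, map_add, Finsupp.degree_single]
        omega
      · simpa using hr
      · simpa using hc
      · simpa [Finsupp.single_apply, hi] using h0
    have h2 := Ideal.mul_mem_left K (monomial (Finsupp.single (i, a) 1) 1) h1
    rwa [mul_sub, monomial_mul, monomial_mul, one_mul] at h2
  by_cases h : ∃ i a, i ≠ i₀ ∧ m (i, a) ≠ 0
  · obtain ⟨i, a, hi, hia⟩ := h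
    have hri : rowSum m' i ≠ 0 := hrow ▸ rowSum_apply_ne_zero hia
    obtain ⟨m₁, rfl⟩ := exists_eq_single_add hia
    obtain ⟨a', m₁', rfl⟩ := exists_eq_single_add_of_rowSum hri
    have hm₁ : m₁ (i₀, 2) = 0 := by simpa [hi] using hm
    have hm₁' : m₁' (i₀, 2) = 0 := by simpa [hi] using hm'
    by_cases haa : a = a'
    · subst haa
      exact shared i a m₁ m₁' hi hN hrow hcol hm₁ hm₁' h₀
    have hca : colSum m₁' a ≠ 0 := by
      have := DFunLike.congr_fun hcol a
      simp [Ne.symm haa] at this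
      omega
    obtain ⟨j, m₂', rfl⟩ := exists_eq_single_add_of_colSum hca
    have hm₂' : m₂' (i₀, 2) = 0 := by
      simp at hm₁'
      exact hm₁'.2
    by_cases hji : i = j
    · subst hji
      rw [add_left_comm (Finsupp.single (i, a') 1)] at hrow hcol ⊢
      exact shared i a _ _ hi hN hrow hcol hm₁ (by simp [hi, hm₂']) h₀
    -- Swapping `(i, a')` and `(j, a)` in the second monomial is allowed unless it creates `(i₀,
    -- 2)`. In that case the first monomial has a variable `(k, 2)` with `k ≠ i₀`, and the swap is
    -- made there.
    by_cases hex : j = i₀ ∧ a' = 2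
    · obtain ⟨hj, rfl⟩ := hex
      have hc2 : colSum m₁ 2 ≠ 0 := by
        have := DFunLike.congr_fun hcol 2
        simp [haa] at this
        omega
      obtain ⟨k, m₂, rfl⟩ := exists_eq_single_add_of_colSum hc2
      have hk : k ≠ i₀ := by
        rintro rfl
        simp at hm₁
      have hm₂ : m₂ (i₀, 2) = 0 := by
        simpa [hk] using hm₁
      by_cases hki : i = k
      · subst hki
        rw [add_left_comm (Finsupp.single (i, a) 1)] at hrow hcol hN h₀ ⊢
        exact shared i 2 _ _ hi hN hrow hcol (by simp [hi, hm₂]) hm₁' h₀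
      · have h1 := hK.swap_mem hi hki (fun h => absurd h hk) hm₂ h₀
        have h2 := shared i 2 (Finsupp.single (k, a) 1 + m₂) _ hi (by rw [← hN]; simp)
          (Eq.trans (by simp) hrow) (Eq.trans (by simp [add_left_comm]) hcol) (by simp [hk, hm₂])
          hm₁' (by simpa using h₀)
        simpa using add_mem h1 h2
    · have h1 := hK.swap_mem (a := a') (b := a) (m := m₂') hi hji
        (fun h => ⟨fun h' => hex ⟨h, h'⟩, by rintro rfl; simp [h] at hm₁'⟩) hm₂' (hrow ▸ h₀)
      have h2 := shared i a m₁ (Finsupp.single (j, a') 1 + m₂') hi hN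
        (hrow.trans (by simp)) (hcol.trans (by simp [add_left_comm])) hm₁
        (by
          simp only [Finsupp.add_apply, hm₂', add_zero]
          rw [Finsupp.single_apply_eq_zero]
          intro h
          exact absurd ⟨(congrArg Prod.fst h).symm, (congrArg Prod.snd h).symm⟩ hex) h₀
      simpa using sub_mem h2 h1
  -- Both monomials now live in row `i₀` alone and are determined by their column sums.
  · push Not at h
    have hsupp : ∀ p : ι × Fin 3 →₀ ℕ, (∀ i, i ≠ i₀ → rowSum p i = 0) →
        (colSum p).mapDomain (fun a => (i₀, a)) = p := by
      intro p hp
      rw [colSum, ← Finsupp.mapDomain_comp]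
      conv_rhs => rw [← Finsupp.mapDomain_id (v := p)]
      refine Finsupp.mapDomain_congr fun x hx => ?_
      by_contra hne
      refine rowSum_apply_ne_zero (i := x.1) (a := x.2) (Finsupp.mem_support_iff.1 hx)
        (hp x.1 fun h => hne ?_)
      simp [← h]
    have hz : ∀ i, i ≠ i₀ → rowSum m i = 0 := by
      intro i hi
      by_contra hne
      obtain ⟨a, p, rfl⟩ := exists_eq_single_add_of_rowSum hne
      have := h i a hi
      simp at this
    rw [← hsupp m hz, ← hsupp m' (by rwa [← hrow]), hcol, sub_self]
    exact K.zero_mem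

/-- The exponent of the image of a monomial under `toricMap`. -/
def toricExponent (m : ι × Fin 3 →₀ ℕ) : ι ⊕ Fin 3 →₀ ℕ :=
  (rowSum m).mapDomain Sum.inl + (colSum m).mapDomain Sum.inr

theorem toricExponent_add (m m' : ι × Fin 3 →₀ ℕ) :
    toricExponent (m + m') = toricExponent m + toricExponent m' := by
  simp only [toricExponent, rowSum_add, colSum_add, Finsupp.mapDomain_add]
  abel

theorem toricExponent_inr (m : ι × Fin 3 →₀ ℕ) (a : Fin 3) :
    toricExponent m (Sum.inr a) = colSum m a := by
  rw [toricExponent, Finsupp.add_apply, Finsupp.mapDomain_of_notMem_range _ _ (by simp), zero_add,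
    Finsupp.mapDomain_apply Sum.inr_injective]

open Classical in
/-- The monomial map whose kernel consists of the minors of the matrix of variables without the
entry `(i₀, 2)`. -/
def toricMap (R : Type*) [CommRing R] (i₀ : ι) :
    MvPolynomial (ι × Fin 3) R →ₐ[R] MvPolynomial (ι ⊕ Fin 3) R :=
  aeval fun x => if x = (i₀, 2) then 0 else X (Sum.inl x.1) * X (Sum.inr x.2)

open Classical in
theorem toricMap_monomial (m : ι × Fin 3 →₀ ℕ) :
    toricMap R i₀ (monomial m 1) =
      if m (i₀, 2) = 0 then monomial (toricExponent m) 1 else 0 := by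
  induction m using Finsupp.induction_linear with
  | zero => simp [toricExponent, rowSum, colSum]
  | add m m' h h' =>
    have : monomial (m + m') (1 : R) = monomial m 1 * monomial m' 1 := by
      rw [monomial_mul, one_mul]
    rw [this, map_mul, h, h', Finsupp.add_apply, toricExponent_add]
    by_cases h1 : m (i₀, 2) = 0 <;> by_cases h2 : m' (i₀, 2) = 0 <;>
      simp [h1, h2, monomial_mul]
  | single x k =>
    rcases x with ⟨i, a⟩
    rw [toricMap, ← X_pow_eq_monomial, map_pow, aeval_X]
    by_cases hx : (i, a) = (i₀, 2)
    · rcases k with _ | k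
      · simp [toricExponent, rowSum, colSum]
      · simp [hx]
    · rw [if_neg hx, if_pos (Finsupp.single_eq_of_ne (Ne.symm hx)), mul_pow, X_pow_eq_monomial,
        X_pow_eq_monomial, monomial_mul, one_mul, toricExponent, rowSum_single, colSum_single,
        Finsupp.mapDomain_single, Finsupp.mapDomain_single]

/-- In degree `d` the quotient map modulo `K` factors through `toricMap`: `L` sends a monomial to
the class of a chosen preimage of degree `d`, and `monomial_sub_mem` makes the choice irrelevant. -/
theorem ContainsLadderMinors.mem_of_toricMap_eq_zero (hK : ContainsLadderMinors K i₀)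
    (hX : X (i₀, 2) ∈ K) {d : ι →₀ ℕ} (hd : d i₀ ≠ 0) {f : MvPolynomial (ι × Fin 3) R}
    (hf : ∀ m ∈ f.support, rowSum m = d) (h0 : toricMap R i₀ f = 0) : f ∈ K := by
  classical
  let Q : (ι ⊕ Fin 3 →₀ ℕ) → (ι × Fin 3 →₀ ℕ) → Prop := fun e m =>
    m (i₀, 2) = 0 ∧ rowSum m = d ∧ toricExponent m = e
  let F : (ι ⊕ Fin 3 →₀ ℕ) → MvPolynomial (ι × Fin 3) R ⧸ K := fun e =>
    if h : ∃ m, Q e m then Ideal.Quotient.mk K (monomial h.choose 1) else 0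
  let L : MvPolynomial (ι ⊕ Fin 3) R →ₗ[R] MvPolynomial (ι × Fin 3) R ⧸ K :=
    (basisMonomials (ι ⊕ Fin 3) R).constr R F
  have hL : ∀ e, L (monomial e 1) = F e := by
    intro e
    have := (basisMonomials (ι ⊕ Fin 3) R).constr_basis R F e
    rwa [coe_basisMonomials] at this
  have hmon : ∀ m, rowSum m = d →
      Ideal.Quotient.mkₐ R K (monomial m 1) = L (toricMap R i₀ (monomial m 1)) := by
    intro m hm
    rw [toricMap_monomial]
    by_cases hz : m (i₀, 2) = 0
    · have hex : ∃ m', Q (toricExponent m) m' := ⟨m, hz, hm, rfl⟩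
      rw [if_pos hz, hL]
      simp only [F, dif_pos hex]
      obtain ⟨h1, h2, h3⟩ := hex.choose_spec
      refine Ideal.Quotient.eq.2 (hK.monomial_sub_mem (hm.trans h2.symm) ?_ hz h1 (hm ▸ hd))
      ext a
      rw [← toricExponent_inr, ← toricExponent_inr, h3]
    · rw [if_neg hz, map_zero]
      obtain ⟨m', rfl⟩ := exists_eq_single_add hz
      refine Ideal.Quotient.eq_zero_iff_mem.2 ?_
      have : monomial (Finsupp.single (i₀, 2) 1 + m') (1 : R) = monomial m' 1 * X (i₀, 2) := by
        rw [X, monomial_mul, one_mul, add_comm]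
      rw [this]
      exact Ideal.mul_mem_left _ _ hX
  have hall : Ideal.Quotient.mkₐ R K f = L (toricMap R i₀ f) := by
    conv_lhs => rw [f.as_sum]
    conv_rhs => rw [f.as_sum]
    simp only [map_sum]
    refine Finset.sum_congr rfl fun m hm => ?_
    have : monomial m (coeff m f) = coeff m f • monomial m (1 : R) := by
      rw [smul_monomial, smul_eq_mul, mul_one]
    rw [this, map_smul, map_smul, map_smul, hmon m (hf m hm)]
  rw [h0, map_zero] at hall
  exact Ideal.Quotient.eq_zero_iff_mem.1 hall

end Toric

/-! ### Weighted degrees -/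

section Weighted

variable {σ τ R M : Type*} [CommRing R] [AddCommMonoid M]

theorem isWeightedHomogeneous_map_monomial {w : σ → M} {v : τ → M}
    (ψ : MvPolynomial σ R →ₐ[R] MvPolynomial τ R)
    (hψ : ∀ s, IsWeightedHomogeneous v (ψ (X s)) (w s)) (m : σ →₀ ℕ) (c : R) :
    IsWeightedHomogeneous v (ψ (monomial m c)) (Finsupp.weight w m) := by
  rw [monomial_eq, map_mul, Finsupp.prod, map_prod, Finsupp.weight_apply, Finsupp.sum,
    ← algebraMap_eq, AlgHom.commutes, algebraMap_eq]
  refine IsWeightedHomogeneous.C_mul (IsWeightedHomogeneous.prod _ _ _ fun s _ => ?_) c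
  rw [map_pow]
  exact (hψ s).pow _

theorem map_weightedHomogeneousComponent {w : σ → M} {v : τ → M}
    (ψ : MvPolynomial σ R →ₐ[R] MvPolynomial τ R)
    (hψ : ∀ s, IsWeightedHomogeneous v (ψ (X s)) (w s)) (d : M) (f : MvPolynomial σ R) :
    ψ (weightedHomogeneousComponent w d f) = weightedHomogeneousComponent v d (ψ f) := by
  classical
  induction f using MvPolynomial.induction_on' with
  | monomial m c =>
    rw [weightedHomogeneousComponent_of_mem (isWeightedHomogeneous_monomial w m c rfl),
      weightedHomogeneousComponent_of_mem (isWeightedHomogeneous_map_monomial ψ hψ m c)]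
    split_ifs <;> simp
  | add p q hp hq => simp only [map_add, hp, hq]

theorem isWeightedHomogeneous_map {w : σ → M} {v : τ → M}
    (ψ : MvPolynomial σ R →ₐ[R] MvPolynomial τ R)
    (hψ : ∀ s, IsWeightedHomogeneous v (ψ (X s)) (w s)) {d : M} {f : MvPolynomial σ R}
    (hf : IsWeightedHomogeneous w f d) : IsWeightedHomogeneous v (ψ f) d := by
  rw [← weightedHomogeneousComponent_eq_self hf, map_weightedHomogeneousComponent ψ hψ]
  exact weightedHomogeneousComponent_isWeightedHomogeneous _ _

theorem weightedHomogeneousComponent_mul_of_right [IsCancelAdd M] {w : σ → M} {e : M}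
    {z : MvPolynomial σ R} (hz : IsWeightedHomogeneous w z e) (d : M) (g : MvPolynomial σ R) :
    weightedHomogeneousComponent w (d + e) (g * z) = weightedHomogeneousComponent w d g * z := by
  classical
  induction g using MvPolynomial.induction_on' with
  | monomial m c =>
    rw [weightedHomogeneousComponent_of_mem (isWeightedHomogeneous_monomial w m c rfl),
      weightedHomogeneousComponent_of_mem
        ((isWeightedHomogeneous_monomial w m c rfl).mul hz)]
    simp only [add_left_inj]
    split_ifs <;> simp
  | add p q hp hq => simp only [map_add, add_mul, hp, hq]

end Weighted

/-- The `ℕⁿ`-grading of the ring of image coordinates. -/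
def imageWeight (x : Fin n × Fin 3) : Fin n →₀ ℕ := Finsupp.single x.1 1

theorem weight_imageWeight (m : Fin n × Fin 3 →₀ ℕ) :
    Finsupp.weight imageWeight m = rowSum m := by
  rw [Finsupp.weight_apply, rowSum, Finsupp.mapDomain]
  simp [imageWeight]

theorem isWeightedHomogeneous_imageForm (i : Fin n) (r : Fin 3 → ℂ) :
    IsWeightedHomogeneous imageWeight (imageForm i r) (Finsupp.single i 1) := by
  rw [imageForm_apply]
  exact IsWeightedHomogeneous.sum _ _ _ fun a _ =>
    IsWeightedHomogeneous.C_mul (isWeightedHomogeneous_X ℂ imageWeight (i, a)) _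

theorem isWeightedHomogeneous_det {m : Type*} {c : Type*} [Fintype c] [DecidableEq c]
    {σ : Type*} {w : σ → (Fin n →₀ ℕ)} (M : Matrix m c (MvPolynomial σ ℂ)) (e : c → Fin n →₀ ℕ)
    (hM : ∀ x y, IsWeightedHomogeneous w (M x y) (e y)) (r : c → m) :
    IsWeightedHomogeneous w (M.submatrix r id).det (∑ y, e y) := by
  rw [Matrix.det_apply']
  refine IsWeightedHomogeneous.sum _ _ _ fun p _ => ?_
  have h := IsWeightedHomogeneous.C_mul (IsWeightedHomogeneous.prod Finset.univ
    (fun y => M.submatrix r id (p y) y) e fun y _ => hM _ _) ((Equiv.Perm.sign p : ℤ) : ℂ)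
  simpa using h

attribute [local instance] MvPolynomial.weightedGradedAlgebra

/-- The degree of an entry of the focal matrix depends only on its column, so every minor is
multihomogeneous. -/
theorem isHomogeneous_focalIdeal (A : Fin n → Camera) (k : ℕ) :
    (focalIdeal A k).IsHomogeneous (weightedHomogeneousSubmodule ℂ imageWeight) := by
  unfold focalIdeal
  rw [Ideal.sum_eq_sup, Finset.sup_eq_iSup]
  refine Ideal.IsHomogeneous.iSup₂ fun σ _ => ?_
  unfold maximalMinors
  refine Ideal.homogeneous_span _ _ ?_
  rintro _ ⟨r, rfl⟩
  refine ⟨_, isWeightedHomogeneous_det (focalMatrix A σ)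
    (Sum.elim (fun _ => 0) (fun j => Finsupp.single (j : Fin n) 1)) ?_ r⟩
  rintro x (b | j)
  · exact isWeightedHomogeneous_C _ _
  · change IsWeightedHomogeneous imageWeight (if x.1 = j then X ((x.1 : Fin n), x.2) else 0) _
    split_ifs with h
    · rw [← h]
      exact isWeightedHomogeneous_X ℂ imageWeight ((x.1 : Fin n), x.2)
    · exact isWeightedHomogeneous_zero _ _ _

/-! ### The parametrization of the multiview variety -/

/-- The linear form with coefficients `g` in the coordinates of the world. -/
def worldForm (n : ℕ) (g : Fin 4 → ℂ) : MvPolynomial (Fin n ⊕ Fin 4) ℂ :=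
  ∑ b, C (g b) * X (Sum.inr b)

theorem worldForm_ne_zero {g : Fin 4 → ℂ} (hg : g ≠ 0) : worldForm n g ≠ 0 := by
  intro h
  apply hg
  ext b
  have := congrArg (eval (Sum.elim 0 (Pi.single b 1))) h
  simpa [worldForm, Pi.single_apply] using this

/-- The parametrization `pᵢ = λᵢ Aᵢ q` of the multiview variety. -/
def param (A : Fin n → Camera) : ImageRing n →ₐ[ℂ] MvPolynomial (Fin n ⊕ Fin 4) ℂ :=
  aeval fun x => X (Sum.inl x.1) * worldForm n ((A x.1).cmat x.2)

theorem param_imageForm (A : Fin n → Camera) (i : Fin n) (r : Fin 3 → ℂ) :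
    param A (imageForm i r) = X (Sum.inl i) * worldForm n (Matrix.vecMul r (A i).cmat) := by
  simp only [imageForm_apply, map_sum, map_mul, param, aeval_X, worldForm, Matrix.vecMul,
    dotProduct, Finset.mul_sum, Finset.sum_mul, algHom_C, algebraMap_eq]
  rw [Finset.sum_comm]
  refine Finset.sum_congr rfl fun b _ => Finset.sum_congr rfl fun a _ => ?_
  ring

theorem eval_param (A : Fin n → Camera) (x : Fin n ⊕ Fin 4 → ℂ) (f : ImageRing n) :
    eval x (param A f) = eval (fun y => x (Sum.inl y.1) *
      ((A y.1).cmat.mulVec (fun b => x (Sum.inr b))) y.2) f := by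
  have h : (aeval x).comp (param A) = aeval (R := ℂ) (fun y : Fin n × Fin 3 => x (Sum.inl y.1) *
      ((A y.1).cmat.mulVec (fun b => x (Sum.inr b))) y.2) := by
    refine MvPolynomial.algHom_ext fun y => ?_
    simp [param, worldForm, Matrix.mulVec, dotProduct]
  have := DFunLike.congr_fun h f
  simpa [AlgHom.comp_apply, aeval_eq_eval] using this

theorem Camera.cmat_mulVec (A : Camera) (q : Fin 4 → ℝ) :
    A.cmat.mulVec (fun b => (q b : ℂ)) = complexify (A.mat.mulVec q) := by
  ext a
  exact (RingHom.map_mulVec Complex.ofRealHom A.mat q a).symm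

theorem multiviewIdeal_le_ker_param (A : Fin n → Camera) {f : ImageRing n}
    (hf : f ∈ multiviewIdeal A) : param A f = 0 := by
  have hrow : ∀ i, (A i).cmat 0 ≠ 0 := by
    intro i h
    have h1 : Matrix.vecMul (Pi.single 0 1) (A i).mat = Matrix.vecMul 0 (A i).mat := by
      ext b
      have := congrFun h b
      simpa [Camera.cmat] using this
    have := congrFun ((A i).vecMul_injective h1) 0
    simp at this
  -- Where `D` does not vanish, `q` is nonzero, every `λᵢ` is nonzero, and `q` is not a focus. Thus
  -- `param A f * D` vanishes at all real points, hence identically.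
  let D : MvPolynomial (Fin n ⊕ Fin 4) ℂ :=
    X (Sum.inr 0) * ∏ i, (X (Sum.inl i) * worldForm n ((A i).cmat 0))
  have hD : D ≠ 0 := by
    refine mul_ne_zero (X_ne_zero _) (Finset.prod_ne_zero_iff.2 fun i _ => ?_)
    exact mul_ne_zero (X_ne_zero _) (worldForm_ne_zero (hrow i))
  suffices h : param A f * D = 0 from (mul_eq_zero.1 h).resolve_right hD
  refine funext_set (fun _ => Set.range (fun x : ℝ => (x : ℂ)))
    (fun _ => Set.infinite_range_of_injective Complex.ofReal_injective) fun x hx => ?_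
  choose y hy using fun s => hx s (Set.mem_univ s)
  obtain rfl : (fun s => (y s : ℂ)) = x := funext hy
  rw [map_mul, map_zero]
  by_cases hDx : eval (fun s => (y s : ℂ)) D = 0
  · rw [hDx, mul_zero]
  simp only [D, map_mul, map_prod, eval_X, mul_eq_zero, Finset.prod_eq_zero_iff, not_or,
    not_exists, Finset.mem_univ, true_and] at hDx
  obtain ⟨hy0, hyi⟩ := hDx
  let q : Fin 4 → ℝ := fun b => y (Sum.inr b)
  have hq : q ≠ 0 := fun h => hy0 (by
    have := congrFun h 0
    simpa [q] using this)
  have hAq : ∀ i, (A i).mat.mulVec q ≠ 0 := by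
    intro i h
    apply (hyi i).2
    have h1 := congrFun ((A i).cmat_mulVec q) 0
    rw [h, map_zero] at h1
    simpa [worldForm, Matrix.mulVec, dotProduct] using h1
  let p : ℙ ℝ (Fin 4 → ℝ) := Projectivization.mk ℝ q hq
  obtain ⟨t, ht⟩ := Projectivization.exists_smul_eq_mk_rep ℝ q hq
  have hp : ∀ i, p ≠ (A i).focus := by
    intro i h
    have h1 := (A i).mulVec_focus_rep
    rw [← h] at h1
    change (A i).mat.mulVec (Projectivization.mk ℝ q hq).rep = 0 at h1
    rw [← ht, Units.smul_def, Matrix.mulVec_smul] at h1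
    exact hAq i ((smul_eq_zero.1 h1).resolve_left t.ne_zero)
  rw [eval_param]
  have hmain := hf (fun i => complexPoint (imageFormation A ⟨p, hp⟩ i)) ⟨⟨p, hp⟩, rfl⟩
    (fun i a => (y (Sum.inl i) : ℂ) * complexify ((A i).mat.mulVec q) a)
    (fun i h => hAq i (complexify_injective (by
      rw [map_zero]
      ext a
      exact (mul_eq_zero.1 (congrFun h a)).resolve_left (hyi i).1)))
    (fun i => by
      simp only [imageFormation, Camera.image, complexPoint, Projectivization.map_mk]
      rw [Projectivization.mk_eq_mk_iff']
      refine ⟨(y (Sum.inl i) : ℂ) * ((t⁻¹ : ℝˣ) : ℝ), ?_⟩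
      change _ • complexify ((A i).mat.mulVec (Projectivization.mk ℝ q hq).rep) = _
      rw [← ht, Units.smul_def, Matrix.mulVec_smul]
      ext a
      have ht0 : ((t : ℝ) : ℂ) ≠ 0 := Complex.ofReal_ne_zero.2 t.ne_zero
      simp only [map_smulₛₗ, Pi.smul_apply, smul_eq_mul, Units.val_inv_eq_inv_val,
        Complex.ofReal_inv, Complex.ofRealHom_eq_coe]
      field_simp)
  simp only [← Camera.cmat_mulVec, q] at hmain
  rw [hmain, zero_mul]

/-! ### The focal polynomials vanish on the multiview variety -/

theorem focalIdeal_le_multiviewIdeal (A : Fin n → Camera) (k : ℕ) :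
    focalIdeal A k ≤ multiviewIdeal A := by
  unfold focalIdeal
  rw [Ideal.sum_eq_sup]
  refine Finset.sup_le fun σ _ => ?_
  unfold maximalMinors
  rw [Ideal.span_le]
  rintro _ ⟨r, rfl⟩ _ ⟨q, rfl⟩ v hv hP
  have hs : ∀ i, ∃ t : ℂ, t • v i = (A i).cmat.mulVec (fun b => (q.1.rep b : ℂ)) := by
    intro i
    have h := hP i
    simp only [imageFormation, Camera.image, complexPoint, Projectivization.map_mk] at h
    obtain ⟨t, ht⟩ := (Projectivization.mk_eq_mk_iff' _ _ _ _ _).1 h.symm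
    exact ⟨t, ht.trans ((A i).cmat_mulVec _).symm⟩
  choose t ht using hs
  rw [RingHom.map_det, ← Matrix.exists_mulVec_eq_zero_iff]
  -- Since `tᵢ vᵢ = Aᵢ q`, the nonzero vector `(q, -t)` is in the kernel of the focal matrix
  -- evaluated at `v`.
  refine ⟨Sum.elim (fun b => (q.1.rep b : ℂ)) (fun j => -t j), ?_, ?_⟩
  · intro h
    apply q.1.rep_nonzero
    ext b
    simpa using congrFun h (Sum.inl b)
  · ext c
    have h := congrFun (ht (r c).1) (r c).2
    simp only [Pi.smul_apply, smul_eq_mul, Matrix.mulVec, dotProduct] at h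
    simp only [Matrix.mulVec, dotProduct, Fintype.sum_sum_type, RingHom.mapMatrix_apply,
      Matrix.map_apply, Matrix.submatrix_apply, id, focalMatrix, Matrix.of_apply, eval_C,
      Sum.elim_inl, Sum.elim_inr, apply_ite (eval _), eval_X, map_zero, ite_mul, zero_mul,
      Finset.sum_ite_eq, Finset.mem_univ, if_true, Pi.zero_apply]
    simp only [Camera.cmat, Matrix.map_apply] at h
    rw [← h]
    ring

/-! ### Adapted coordinates -/

namespace AdaptedFrame

variable {A : Fin n → Camera} {i₀ : Fin n} (F : AdaptedFrame A i₀)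

/-- The substitution of the adapted coordinates for the variables. -/
def coordMap : ImageRing n →ₐ[ℂ] ImageRing n := aeval F.coord

/-- The inverse of `coordMap`. -/
def coordInv : ImageRing n →ₐ[ℂ] ImageRing n :=
  aeval fun x => imageForm x.1 ((F.P x.1)⁻¹ x.2)

theorem coordMap_X (x : Fin n × Fin 3) : F.coordMap (X x) = F.coord x := aeval_X _ _

theorem coordMap_imageForm (i : Fin n) (r : Fin 3 → ℂ) :
    F.coordMap (imageForm i r) = imageForm i (Matrix.vecMul r (F.P i)) := by
  simp only [imageForm_apply, map_sum, map_mul, coordMap_X, coord, Matrix.vecMul, dotProduct,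
    Finset.mul_sum, Finset.sum_mul, algHom_C, algebraMap_eq]
  rw [Finset.sum_comm]
  refine Finset.sum_congr rfl fun b _ => Finset.sum_congr rfl fun a _ => ?_
  ring

theorem coordMap_coordInv (f : ImageRing n) : F.coordMap (F.coordInv f) = f := by
  have h : F.coordMap.comp F.coordInv = AlgHom.id ℂ _ := by
    refine MvPolynomial.algHom_ext fun x => ?_
    rw [AlgHom.comp_apply, coordInv, aeval_X, coordMap_imageForm, AlgHom.id_apply,
      ← Matrix.mul_apply_eq_vecMul, Matrix.nonsing_inv_mul _ (F.isUnit_det_P x.1), imageForm_apply]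
    simp [Matrix.one_apply]
  exact DFunLike.congr_fun h f

/-- The restriction of the parametrization to the plane of the frame. -/
def restrict : MvPolynomial (Fin n ⊕ Fin 4) ℂ →ₐ[ℂ] MvPolynomial (Fin n ⊕ Fin 3) ℂ :=
  aeval (Sum.elim (fun i => X (Sum.inl i))
    (fun b => ∑ c : Fin 3, C (F.G⁻¹ b c.castSucc) * X (Sum.inr c)))

theorem restrict_worldForm (x : Fin 4) :
    F.restrict (worldForm n (F.G x)) =
      ∑ c : Fin 3, C ((1 : Matrix (Fin 4) (Fin 4) ℂ) x c.castSucc) * X (Sum.inr c) := by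
  rw [← Matrix.mul_nonsing_inv _ F.isUnit_det_G]
  simp only [worldForm, map_sum, map_mul, restrict, aeval_X, Sum.elim_inr, Matrix.mul_apply,
    Finset.mul_sum, Finset.sum_mul, algHom_C, algebraMap_eq]
  rw [Finset.sum_comm]
  refine Finset.sum_congr rfl fun b _ => Finset.sum_congr rfl fun a _ => ?_
  ring

theorem restrict_worldForm_castSucc (a : Fin 3) :
    F.restrict (worldForm n (F.G a.castSucc)) = X (Sum.inr a) := by
  rw [restrict_worldForm]
  simp [Matrix.one_apply]

theorem restrict_worldForm_last : F.restrict (worldForm n (F.G (Fin.last 3))) = 0 := by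
  rw [restrict_worldForm]
  refine Finset.sum_eq_zero fun c _ => ?_
  rw [Matrix.one_apply_ne (Fin.castSucc_lt_last c).ne', map_zero, zero_mul]

theorem param_coord_two :
    param A (F.coord (i₀, 2)) = X (Sum.inl i₀) * worldForm n (F.G (Fin.last 3)) := by
  rw [coord, param_imageForm, F.vecMul_two]

/-- On the plane the corrections `α` disappear: cameras other than `i₀` become the identity, and
`i₀` forgets the third plane coordinate. -/
theorem restrict_param_coordMap (f : ImageRing n) :
    F.restrict (param A (F.coordMap f)) = toricMap ℂ i₀ f := by
  have hadd : ∀ (g h : Fin 4 → ℂ) (t : ℂ),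
      worldForm n (g + t • h) = worldForm n g + C t * worldForm n h := by
    intro g h t
    simp [worldForm, add_mul, Finset.sum_add_distrib, Finset.mul_sum, mul_assoc]
  have hl : ∀ i, F.restrict (X (Sum.inl i)) = X (Sum.inl i) := fun i => aeval_X _ _
  have h : F.restrict.comp ((param A).comp F.coordMap) = toricMap ℂ i₀ := by
    refine MvPolynomial.algHom_ext fun x => ?_
    rcases x with ⟨i, a⟩
    rw [AlgHom.comp_apply, AlgHom.comp_apply, coordMap_X, toricMap, aeval_X, coord,
      param_imageForm, map_mul, hl]
    by_cases hi : i = i₀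
    · subst hi
      fin_cases a
      · simpa [F.vecMul_zero] using F.restrict_worldForm_castSucc 0
      · simpa [F.vecMul_one] using F.restrict_worldForm_castSucc 1
      · simpa [F.vecMul_two] using F.restrict_worldForm_last
    · rw [if_neg (fun h => hi (congrArg Prod.fst h)), F.vecMul_of_ne i hi, hadd, map_add, map_mul,
        restrict_worldForm_castSucc, restrict_worldForm_last, mul_zero, add_zero]
  exact DFunLike.congr_fun h f

theorem containsLadderMinors {J : Ideal (ImageRing n)} (h2 : focalIdeal A 2 ≤ J)
    (h3 : focalIdeal A 3 ≤ J) :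
    ContainsLadderMinors ((J ⊔ Ideal.span {F.coord (i₀, 2)}).comap F.coordMap) i₀ where
  bifocal i hi := by
    simp only [Ideal.mem_comap, map_sub, map_mul, coordMap_X]
    exact sup_le_sup_right h2 _ (F.bifocal_mem hi)
  trifocal i j hi hj hij a b c hc := by
    simp only [Ideal.mem_comap, map_sub, map_mul, coordMap_X]
    exact sup_le_sup_right h3 _ (F.trifocal_mem hi hj hij a b c hc)

/-- A multihomogeneous relation of positive degree in the coordinates of the camera `i₀` lies,
modulo the bifocal and trifocal polynomials, in the ideal of the plane of the frame. -/
theorem mem_sup_of_param_eq_zero {J : Ideal (ImageRing n)} (h2 : focalIdeal A 2 ≤ J)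
    (h3 : focalIdeal A 3 ≤ J) {d : Fin n →₀ ℕ} (hd : d i₀ ≠ 0) {f : ImageRing n}
    (hf : IsWeightedHomogeneous imageWeight f d) (h0 : param A f = 0) :
    f ∈ J ⊔ Ideal.span {F.coord (i₀, 2)} := by
  have hhom : IsWeightedHomogeneous imageWeight (F.coordInv f) d := by
    refine isWeightedHomogeneous_map F.coordInv (fun x => ?_) hf
    rw [coordInv, aeval_X]
    exact isWeightedHomogeneous_imageForm _ _
  have key := (F.containsLadderMinors h2 h3).mem_of_toricMap_eq_zero (f := F.coordInv f) ?_ hd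
    (fun m hm => by rw [← weight_imageWeight]; exact hhom (mem_support_iff.1 hm)) ?_
  · rwa [Ideal.mem_comap, coordMap_coordInv] at key
  · rw [Ideal.mem_comap, coordMap_X]
    exact Ideal.mem_sup_right (Ideal.mem_span_singleton_self _)
  · rw [← F.restrict_param_coordMap, coordMap_coordInv, h0, map_zero]

end AdaptedFrame

/-! ### The main induction -/

theorem mem_of_param_eq_zero_of_isWeightedHomogeneous (A : Fin n → Camera)
    (hA : Pairwise fun i j => (A i).focus ≠ (A j).focus) {d : Fin n →₀ ℕ} {f : ImageRing n}
    (hf : IsWeightedHomogeneous imageWeight f d) (h0 : param A f = 0) :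
    f ∈ focalIdeal A 2 ⊔ focalIdeal A 3 := by
  classical
  induction hN : d.degree using Nat.strong_induction_on generalizing d f with
  | _ N ih =>
  by_cases hd : d = 0
  · subst hd
    have hC : f = C (coeff 0 f) := by
      ext m
      rw [coeff_C]
      split_ifs with hm
      · rw [hm]
      · by_contra hne
        have h1 := hf hne
        rw [weight_imageWeight] at h1
        apply hm
        ext ⟨i, a⟩
        by_contra hia
        exact rowSum_apply_ne_zero (Ne.symm hia) (by rw [h1, Finsupp.zero_apply])
    rw [hC, algHom_C, algebraMap_eq, C_eq_zero] at h0
    rw [hC, h0, map_zero]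
    exact Ideal.zero_mem _
  · obtain ⟨i₀, hi₀⟩ := Finsupp.ne_iff.1 hd
    rw [Finsupp.zero_apply] at hi₀
    obtain ⟨F⟩ := exists_adaptedFrame A hA i₀
    have hmem := F.mem_sup_of_param_eq_zero le_sup_left le_sup_right hi₀ hf h0
    obtain ⟨j, hj, z, hz, hjz⟩ := Submodule.mem_sup.1 hmem
    -- Neither `j` nor `g` need be homogeneous; taking components of `f = j + g z` in degree `d`
    -- repairs this, as `J` is homogeneous.
    obtain ⟨g, rfl⟩ := Ideal.mem_span_singleton'.1 hz
    obtain ⟨d', rfl⟩ := exists_eq_single_add hi₀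
    have hcomp : f = weightedHomogeneousComponent imageWeight (Finsupp.single i₀ 1 + d') j +
        weightedHomogeneousComponent imageWeight d' g * F.coord (i₀, 2) := by
      conv_lhs => rw [← weightedHomogeneousComponent_eq_self hf, ← hjz, map_add]
      rw [add_comm (Finsupp.single i₀ 1) d', weightedHomogeneousComponent_mul_of_right
        (z := F.coord (i₀, 2)) (isWeightedHomogeneous_imageForm _ _)]
    have hhom : (focalIdeal A 2 ⊔ focalIdeal A 3).IsHomogeneous
        (weightedHomogeneousSubmodule ℂ imageWeight) :=
      (isHomogeneous_focalIdeal A 2).sup (isHomogeneous_focalIdeal A 3)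
    have hjd := weightedHomogeneousComponent_mem_of_mem ℂ imageWeight hhom hj
      (Finsupp.single i₀ 1 + d')
    have hker : param A (weightedHomogeneousComponent imageWeight
        (Finsupp.single i₀ 1 + d') j) = 0 :=
      multiviewIdeal_le_ker_param A (sup_le (focalIdeal_le_multiviewIdeal A 2)
        (focalIdeal_le_multiviewIdeal A 3) hjd)
    have hg : param A (weightedHomogeneousComponent imageWeight d' g) = 0 := by
      rw [hcomp, map_add, hker, zero_add, map_mul, F.param_coord_two] at h0
      refine (mul_eq_zero.1 h0).resolve_right (mul_ne_zero (X_ne_zero _) (worldForm_ne_zero ?_))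
      intro h
      exact F.isUnit_det_G.ne_zero (Matrix.det_eq_zero_of_row_eq_zero _ (congrFun h))
    rw [hcomp]
    refine add_mem hjd (Ideal.mul_mem_right _ _ (ih d'.degree ?_
      (weightedHomogeneousComponent_isWeightedHomogeneous _ _) hg rfl))
    rw [← hN, map_add, Finsupp.degree_single]
    omega

theorem mem_of_param_eq_zero (A : Fin n → Camera)
    (hA : Pairwise fun i j => (A i).focus ≠ (A j).focus) {f : ImageRing n}
    (h0 : param A f = 0) : f ∈ focalIdeal A 2 ⊔ focalIdeal A 3 := by
  classical
  rw [mem_iff_weightedHomogeneousComponent_mem ℂ imageWeight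
    ((isHomogeneous_focalIdeal A 2).sup (isHomogeneous_focalIdeal A 3))]
  intro d
  refine mem_of_param_eq_zero_of_isWeightedHomogeneous A hA
    (weightedHomogeneousComponent_isWeightedHomogeneous _ _) (d := d) ?_
  -- With `λᵢ` of weight `i` and world coordinates of weight zero, `param` is graded, so its kernel
  -- contains all components of `f`.
  rw [map_weightedHomogeneousComponent (v := Sum.elim (fun i => Finsupp.single i 1) (fun _ => 0)),
    h0, map_zero]
  intro x
  rw [param, aeval_X, ← add_zero (imageWeight x)]
  refine IsWeightedHomogeneous.mul (isWeightedHomogeneous_X ℂ _ (Sum.inl x.1)) ?_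
  exact IsWeightedHomogeneous.sum _ _ _ fun b _ =>
    IsWeightedHomogeneous.C_mul (isWeightedHomogeneous_X ℂ _ (Sum.inr b)) _

end Multiview

end

theorem mainTheorem1 {n : ℕ} (A : Fin n → Multiview.Camera)
    (hA : Pairwise fun i j => (A i).focus ≠ (A j).focus) :
    Multiview.multiviewIdeal A = Multiview.focalIdeal A 2 + Multiview.focalIdeal A 3 := by
  refine le_antisymm (fun f hf => ?_) (sup_le ?_ ?_)
  · exact Multiview.mem_of_param_eq_zero A hA (Multiview.multiviewIdeal_le_ker_param A hf)
  · exact Multiview.focalIdeal_le_multiviewIdeal A 2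
  · exact Multiview.focalIdeal_le_multiviewIdeal A 3
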